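/- For $n\ge 0$ let $B^{(n)}=\mathbb{F}_2[X_1,\dots,X_n]/(X_1^2,\dots,X_n^2)$, graded by degree, with $B^{(n)}_k$ the subspace of homogeneous elements of degree $k$. For a nonzero homogeneous element $\lambda\in B^{(n)}$ of degree $d\ge 1$, let $\mathrm{ind}(\lambda)$ be the least $k\ge 0$ with $B^{(n)}_k\subseteq(\lambda)$; the element $\lambda$ is called semi-regular if every homogeneous $\mu\in B^{(n)}$ with $\mu\lambda=0$ and $\deg\mu+d<\mathrm{ind}(\lambda)$ lies in the ideal $(\lambda)$. (By convention the element $0$ is not semi-regular.) Let $\sigma_{d,n}\in B^{(n)}$ be the image of the elementary symmetric polynomial $\sum_{1\le i_1<\cdots<i_d\le n}X_{i_1}\cdots X_{i_d}$. Theorem. Let $d\ge 2$, and write $d=2^m l$ with $l$ odd and $m\ge 0$. Let $n\ge 0$. (a) If $l>1$, then $\sigma_{d,n}$ is semi-regular if and only if $d\le n\le d+2^{m+1}-1$. (b) If $l=1$, then $\sigma_{d,n}$ is semi-regular if and only if $d\le n\le d+2^{m+1}$. In particular, $\sigma_{2^t,3\cdot 2^t}$ is semi-regular for every $t\ge 1$;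 hence there are infinitely many $d\ge 2$ for which $B^{(n)}$ with $n=3d$ contains a semi-regular element of degree $d$. -/

import Mathlib

noncomputable section

namespace SemiRegular

/-- The algebra `B^{(n)} = 𝔽₂[X₁, …, Xₙ] / (X₁², …, Xₙ²)`. -/
abbrev B (n : ℕ) : Type :=
  MvPolynomial (Fin n) (ZMod 2) ⧸
    Ideal.span (Set.range fun i : Fin n => (MvPolynomial.X i : MvPolynomial (Fin n) (ZMod 2)) ^ 2)

/-- The subspace `B^{(n)}_k` of homogeneous elements of degree `k`: the image of the homogeneous
polynomials of degree `k`. -/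
def homogeneousPart (n k : ℕ) : Submodule (ZMod 2) (B n) :=
  (MvPolynomial.homogeneousSubmodule (Fin n) (ZMod 2) k).map
    (Ideal.Quotient.mkₐ (ZMod 2) (Ideal.span (Set.range fun i : Fin n =>
      (MvPolynomial.X i : MvPolynomial (Fin n) (ZMod 2)) ^ 2))).toLinearMap

/-- The index of `B^{(n)} / I`: the least `k` with `B^{(n)}_k ⊆ I`.
(Such a `k` always exists, since `B^{(n)}_{n+1} = 0`.) -/
def index {n : ℕ} (I : Ideal (B n)) : ℕ :=
  sInf {k : ℕ | ∀ b ∈ homogeneousPart n k, b ∈ I}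

/-- `D`-semi-regularity of a sequence `f₁, …, fᵣ`: whenever `μ` is homogeneous,
`μ fᵢ ∈ (f₁, …, fᵢ₋₁)` and `deg μ + deg fᵢ < D`, then `μ ∈ (f₁, …, fᵢ)`. -/
def IsSemiRegularUpTo {n r : ℕ} (D : ℕ) (f : Fin r → B n) : Prop :=
  ∀ (i : Fin r) (a e : ℕ) (μ : B n),
    μ ∈ homogeneousPart n a → f i ∈ homogeneousPart n e → a + e < D →
    μ * f i ∈ Ideal.span (f '' Set.Iio i) → μ ∈ Ideal.span (f '' Set.Iic i)

/-- A sequence of (nonzero) homogeneous elements of positive degree is semi-regular if it is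
`D`-semi-regular for `D` the index of the ideal that it generates. -/
def IsSemiRegular {n r : ℕ} (f : Fin r → B n) : Prop :=
  (∀ i, f i ≠ 0 ∧ ∃ e : ℕ, 0 < e ∧ f i ∈ homogeneousPart n e) ∧
    IsSemiRegularUpTo (index (Ideal.span (Set.range f))) f

/-- A single element is semi-regular if it is so as a sequence of length one. -/
def IsSemiRegularElement {n : ℕ} (g : B n) : Prop :=
  IsSemiRegular (fun _ : Fin 1 => g)

/-- The image `σ_{d,n}` in `B^{(n)}` of the `d`-th elementary symmetric polynomial in `n`
variables. -/
def sigma (d n : ℕ) : B n :=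
  Ideal.Quotient.mk _ (MvPolynomial.esymm (Fin n) (ZMod 2) d)

end SemiRegular

end

/-!
In the basis of squarefree monomials, `B n` is the space of functions on the subsets of an `n`-set
with values in the field of two elements, and multiplication by `sigma d n` from degree `a` to
degree `a + d` is the inclusion matrix of `a`-subsets against `(a + d)`-subsets.

Write `h R` for the sum of the coefficients of an element `b` of degree `a` over the `a`-subsets
of `R`. If `b * sigma d n = 0`, then `h` vanishes on sets of size `a + d`, and double counting gives
`choose (d + j) d * h R = 0` for `#R = a + d + j`. If `2 ^ m ∣ d`, this binomial coefficient is odd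
for `j < 2 ^ m`, so `h` vanishes on all sets of sizes from `a + d` to `a + d + 2 ^ m - 1`. By
inclusion–exclusion the coefficient of `b` at `U` is the sum of `h (D ∪ X)` over `X ⊆ U`, for any
`D` disjoint from `U`. With `#D = a + d` this shows that multiplication is injective in degree `a`
when `a < 2 ^ m` and `2 * a + d ≤ n` (`eq_zero_of_mul_sigma_eq_zero`). For `n = 3 * d`,
`a = d = 2 ^ m` the only surviving term is `h univ`, so the kernel is spanned by `sigma d n`
(`exists_smul_sigma_eq`). Complementation transposes the inclusion matrices, hence injectivity below
the middle degree is surjectivity above it (`sigmaRank_compl`,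
`homogeneousPart_le_map_mulRight_sigma`). Together these give semi-regularity in the stated range.

Conversely, a nonzero annihilator of degree `e` forces the index above `n - e` (`sub_lt_index`). Let
`d = 2 ^ m * l` with `l` odd. Then `sigma (2 ^ m) n` annihilates `sigma d n`; for `l > 1` its degree
is too small for the ideal, so semi-regularity fails as soon as that degree is below the index. For
`l = 1` and `n > 3 * d`, take `sigma d n` itself as the annihilator: semi-regularity would make
multiplication by `sigma d n` exact in all degrees up to `n - 2 * d`. If `n < 4 * d`, the dimension
count in degree `n - 2 * d` contradicts `choose_add_choose_lt`. If `n ≥ 4 * d`, duality makes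
multiplication exact in all degrees, so that the Hilbert polynomial `(1 + X) ^ n` would be divisible
by `1 + X ^ d`, which is impossible for even `d` (`not_forall_choose_eq_add`).
-/

namespace SemiRegular

open Finset

/-! ### Binomial coefficients modulo two -/

theorem choose_two_mul_add_modEq (x y e : ℕ) (he : e < 2) :
    (2 * x + e).choose (2 * y) ≡ x.choose y [MOD 2] := by
  have h := Choose.choose_modEq_choose_mod_mul_choose_div_nat (p := 2)
    (n := 2 * x + e) (k := 2 * y)
  rw [show (2 * x + e) / 2 = x by omega, show 2 * y / 2 = y by omega,
    show 2 * y % 2 = 0 by omega] at h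
  simpa using h

theorem choose_two_pow_mul_modEq (m x y : ℕ) :
    (2 ^ m * x).choose (2 ^ m * y) ≡ x.choose y [MOD 2] := by
  induction m with
  | zero => simp [Nat.ModEq]
  | succ m ih =>
    have h := choose_two_mul_add_modEq (2 ^ m * x) (2 ^ m * y) 0 (by norm_num)
    rw [pow_succ', mul_assoc, mul_assoc]
    exact h.trans ih

/-- Adding `j < 2 ^ m` to a multiple of `2 ^ m` produces no carry in base two. -/
theorem odd_choose_add {m d j : ℕ} (hd : 2 ^ m ∣ d) (hj : j < 2 ^ m) :
    Odd ((d + j).choose d) := by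
  induction m generalizing d j with
  | zero =>
    have : j = 0 := by simpa using hj
    simp [this]
  | succ m ih =>
    obtain ⟨c, rfl⟩ := hd
    have h := choose_two_mul_add_modEq (2 ^ m * c + j / 2) (2 ^ m * c) (j % 2)
      (Nat.mod_lt _ (by norm_num))
    rw [pow_succ'] at hj
    have h2 := ih (d := 2 ^ m * c) (j := j / 2) (dvd_mul_right _ _) (by omega)
    rw [show 2 * (2 ^ m * c + j / 2) + j % 2 = 2 ^ (m + 1) * c + j by
      rw [pow_succ', mul_assoc]; omega, show 2 * (2 ^ m * c) = 2 ^ (m + 1) * c by ring] at h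
    exact Nat.odd_iff.2 (Eq.trans h (Nat.odd_iff.1 h2))

theorem even_choose_two_pow_mul_succ {m l : ℕ} (hl : Odd l) :
    Even ((2 ^ m * l + 2 ^ m).choose (2 ^ m)) := by
  have h := choose_two_pow_mul_modEq m (l + 1) 1
  rw [Nat.choose_one_right, mul_one, mul_add, mul_one] at h
  rw [Nat.even_iff, h]
  exact Nat.even_iff.1 hl.add_one

/-! ### Subset sums over the field with two elements -/

variable {α : Type*} [DecidableEq α]

/-- The sum of a function on finite sets over all `a`-element subsets of `R`. -/
def subsetSum (v : Finset α → ZMod 2) (a : ℕ) (R : Finset α) : ZMod 2 :=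
  ∑ S ∈ R.powersetCard a, v S

/-- Each `a`-subset of `R` lies in `choose (#R - a) (b - a)` of the `b`-subsets of `R`. -/
theorem sum_powersetCard_subsetSum (v : Finset α → ZMod 2) {a b : ℕ} (hab : a ≤ b)
    (R : Finset α) :
    ∑ Q ∈ R.powersetCard b, subsetSum v a Q = ((#R - a).choose (b - a) : ℕ) * subsetSum v a R := by
  unfold subsetSum
  rw [Finset.sum_comm' (t' := R.powersetCard a) (s' := fun S => {Q ∈ R.powersetCard b | S ⊆ Q})]
  · rw [Finset.mul_sum]
    refine Finset.sum_congr rfl fun S hS => ?_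
    rw [mem_powersetCard] at hS
    rw [sum_const, card_filter_powersetCard_subset _ _ _ hS.1 (by omega), nsmul_eq_mul, hS.2]
  · intro Q S
    simp only [mem_powersetCard, mem_filter]
    constructor
    · rintro ⟨⟨h1, h2⟩, h3, h4⟩
      exact ⟨⟨⟨h1, h2⟩, h3⟩, h3.trans h1, h4⟩
    · rintro ⟨⟨⟨h1, h2⟩, h3⟩, h4, h5⟩
      exact ⟨⟨h1, h2⟩, h3, h5⟩

/-- If the subset sums vanish on all sets of size `a + d`, they vanish on the slightly larger sets:
the multiplicity in the double count is odd there. -/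
theorem subsetSum_eq_zero {v : Finset α → ZMod 2} {a d m : ℕ} (hd : 2 ^ m ∣ d)
    (h : ∀ R : Finset α, #R = a + d → subsetSum v a R = 0)
    {R : Finset α} (h1 : a + d ≤ #R) (h2 : #R < a + d + 2 ^ m) : subsetSum v a R = 0 := by
  have key := sum_powersetCard_subsetSum v (Nat.le_add_right a d) R
  rw [sum_eq_zero fun Q hQ => h Q (mem_powersetCard.1 hQ).2] at key
  have hodd : Odd ((d + (#R - a - d)).choose d) := odd_choose_add hd (by omega)
  rw [show a + d - a = d by omega, show #R - a = d + (#R - a - d) by omega,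
    hodd.natCast_zmod_two] at key
  simpa using key.symm

/-- Inclusion–exclusion: a set `S ⊆ D ∪ U` of size `a` lies in `2 ^ (a - #(S \ D))` of the sets
`D ∪ X` with `X ⊆ U`, which is an odd number only if `S = U`. -/
theorem sum_powerset_subsetSum_union (v : Finset α → ZMod 2) {a : ℕ} {D U : Finset α}
    (hD : Disjoint D U) (hU : #U = a) : ∑ X ∈ U.powerset, subsetSum v a (D ∪ X) = v U := by
  unfold subsetSum
  rw [Finset.sum_comm' (t' := (D ∪ U).powersetCard a) (s' := fun S => Icc (S \ D) U)]
  · rw [Finset.sum_eq_single U]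
    · rw [hD.symm.sdiff_eq_left]
      simp
    · intro S hS hSU
      rw [mem_powersetCard] at hS
      have hsub : S \ D ⊆ U := by
        exact sdiff_le_iff.2 hS.1
      have hlt : #(S \ D) < #U := by
        refine lt_of_le_of_ne (card_le_card hsub) fun he => hSU ?_
        have h1 := eq_of_subset_of_card_le hsub he.ge
        refine (eq_of_subset_of_card_le ?_ (by omega)).symm
        rw [← h1]
        exact sdiff_subset
      rw [sum_const, card_Icc_finset hsub, nsmul_eq_mul]
      have : ((2 ^ (#U - #(S \ D)) : ℕ) : ZMod 2) = 0 := by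
        rw [Nat.cast_pow, show ((2 : ℕ) : ZMod 2) = 0 from rfl, zero_pow (by omega)]
      rw [this, zero_mul]
    · intro h
      exact absurd (mem_powersetCard.2 ⟨subset_union_right, hU⟩) h
  · intro X S
    have hiff : S \ D ⊆ X ↔ S ⊆ D ∪ X := sdiff_le_iff
    simp only [mem_powerset, mem_powersetCard, mem_Icc, hiff]
    constructor
    · rintro ⟨h1, h2, h3⟩
      exact ⟨⟨h2, h1⟩, h2.trans (union_subset_union_right h1), h3⟩
    · rintro ⟨⟨h1, h2⟩, h3, h4⟩
      exact ⟨h2, h1, h4⟩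

/-! ### Squarefree coordinates on `B n` -/

/-- The exponent vector of the squarefree monomial `∏ i ∈ S, X i`. -/
noncomputable def sqfreeExponent {n : ℕ} (S : Finset (Fin n)) : Fin n →₀ ℕ :=
  ∑ i ∈ S, Finsupp.single i 1

theorem sqfreeExponent_apply {n : ℕ} (S : Finset (Fin n)) (i : Fin n) :
    sqfreeExponent S i = if i ∈ S then 1 else 0 := by
  simp [sqfreeExponent, Finsupp.finsetSum_apply, Finsupp.single_apply]

theorem sqfreeExponent_injective {n : ℕ} :
    Function.Injective (sqfreeExponent : Finset (Fin n) → Fin n →₀ ℕ) := by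
  intro S T h
  ext i
  have := DFunLike.congr_fun h i
  rw [sqfreeExponent_apply, sqfreeExponent_apply] at this
  by_cases h1 : i ∈ S <;> by_cases h2 : i ∈ T <;> simp_all

theorem degree_sqfreeExponent {n : ℕ} (S : Finset (Fin n)) :
    (sqfreeExponent S).degree = #S := by
  simp [sqfreeExponent]

theorem exists_sqfreeExponent_eq {n : ℕ} {x : Fin n →₀ ℕ} (hx : ∀ i, x i < 2) :
    ∃ S, sqfreeExponent S = x := by
  refine ⟨x.support, ?_⟩
  ext i
  rw [sqfreeExponent_apply]
  have := hx i
  by_cases h : x i = 0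
  · simp [h]
  · simp [h]
    omega

/-- The ideal generated by the squares is the monomial ideal spanned by the monomials that are not
squarefree. -/
theorem mk_eq_zero_iff {n : ℕ} (p : MvPolynomial (Fin n) (ZMod 2)) :
    (Ideal.Quotient.mk _ p : B n) = 0 ↔ ∀ S, p.coeff (sqfreeExponent S) = 0 := by
  have hspan : (Set.range fun i : Fin n => (MvPolynomial.X i : MvPolynomial (Fin n) (ZMod 2)) ^ 2)
      = (fun s => MvPolynomial.monomial s (1 : ZMod 2)) ''
        Set.range fun i : Fin n => Finsupp.single i 2 := by
    rw [← Set.range_comp]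
    congr 1
    funext i
    exact MvPolynomial.X_pow_eq_monomial
  rw [Ideal.Quotient.eq_zero_iff_mem, hspan, MvPolynomial.mem_ideal_span_monomial_image]
  constructor
  · intro h S
    by_contra hS
    obtain ⟨_, ⟨i, rfl⟩, hi⟩ := h _ (MvPolynomial.mem_support_iff.2 hS)
    have := hi i
    rw [sqfreeExponent_apply] at this
    simp only [Finsupp.single_eq_same] at this
    split_ifs at this <;> omega
  · intro h x hx
    by_contra! hcon
    obtain ⟨S, rfl⟩ := exists_sqfreeExponent_eq (x := x) fun i => by
      by_contra! hi
      exact hcon _ ⟨i, rfl⟩ (Finsupp.single_le_iff.2 hi)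
    exact MvPolynomial.mem_support_iff.1 hx (h S)

/-- The coordinates of an element of `B n` in the basis of squarefree monomials, indexed by the
set of variables that occur. -/
noncomputable def coords (n : ℕ) : B n →ₗ[ZMod 2] (Finset (Fin n) → ZMod 2) :=
  Submodule.liftQ
    ((Ideal.span (Set.range fun i : Fin n =>
      (MvPolynomial.X i : MvPolynomial (Fin n) (ZMod 2)) ^ 2)).restrictScalars (ZMod 2))
    (LinearMap.pi fun S => MvPolynomial.lcoeff (ZMod 2) (sqfreeExponent S))
    (fun p hp => by
      ext S
      exact (mk_eq_zero_iff p).1 (Ideal.Quotient.eq_zero_iff_mem.2 hp) S) ∘ₗ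
  (Submodule.Quotient.restrictScalarsEquiv (ZMod 2) (Ideal.span (Set.range fun i : Fin n =>
      (MvPolynomial.X i : MvPolynomial (Fin n) (ZMod 2)) ^ 2))).symm.toLinearMap

theorem coords_mk {n : ℕ} (p : MvPolynomial (Fin n) (ZMod 2)) (S : Finset (Fin n)) :
    coords n (Ideal.Quotient.mk _ p) S = p.coeff (sqfreeExponent S) := rfl

theorem coords_injective (n : ℕ) : Function.Injective (coords n) := by
  rw [injective_iff_map_eq_zero]
  intro b hb
  obtain ⟨p, rfl⟩ := Ideal.Quotient.mk_surjective b
  exact (mk_eq_zero_iff p).2 fun S => congrFun hb S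

/-- The squarefree monomial `∏ i ∈ S, X i` in `B n`. -/
noncomputable def sqfreeMonomial {n : ℕ} (S : Finset (Fin n)) : B n :=
  Ideal.Quotient.mk _ (MvPolynomial.monomial (sqfreeExponent S) 1)

theorem coords_sqfreeMonomial {n : ℕ} (S T : Finset (Fin n)) :
    coords n (sqfreeMonomial S) T = if S = T then 1 else 0 := by
  rw [sqfreeMonomial, coords_mk, MvPolynomial.coeff_monomial]
  simp only [sqfreeExponent_injective.eq_iff]

theorem coords_surjective (n : ℕ) : Function.Surjective (coords n) := by
  intro f
  refine ⟨∑ S, f S • sqfreeMonomial S, ?_⟩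
  ext T
  simp [map_sum, Finset.sum_apply, coords_sqfreeMonomial]

/-- `coords` as a linear equivalence. -/
noncomputable def coordsEquiv (n : ℕ) : B n ≃ₗ[ZMod 2] (Finset (Fin n) → ZMod 2) :=
  LinearEquiv.ofBijective (coords n) ⟨coords_injective n, coords_surjective n⟩

instance (n : ℕ) : FiniteDimensional (ZMod 2) (B n) :=
  (coordsEquiv n).symm.finiteDimensional

theorem sqfreeMonomial_mem {n : ℕ} (S : Finset (Fin n)) :
    sqfreeMonomial S ∈ homogeneousPart n #S := by
  refine ⟨_, MvPolynomial.isHomogeneous_monomial 1 (degree_sqfreeExponent S), rfl⟩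

theorem mem_homogeneousPart_iff {n k : ℕ} {b : B n} :
    b ∈ homogeneousPart n k ↔ ∀ S, #S ≠ k → coords n b S = 0 := by
  constructor
  · rintro ⟨p, hp, rfl⟩ S hS
    have hp' : p.IsHomogeneous k := hp
    exact hp'.coeff_eq_zero (by rwa [degree_sqfreeExponent])
  · intro h
    have hb : b = ∑ S, coords n b S • sqfreeMonomial S := by
      apply coords_injective
      ext T
      simp [map_sum, Finset.sum_apply, coords_sqfreeMonomial]
    rw [hb]
    refine Submodule.sum_mem _ fun S _ => ?_
    by_cases hS : #S = k
    · exact Submodule.smul_mem _ _ (hS ▸ sqfreeMonomial_mem S)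
    · rw [h S hS, zero_smul]
      exact Submodule.zero_mem _

theorem coords_mul {n : ℕ} (b c : B n) (R : Finset (Fin n)) :
    coords n (b * c) R = ∑ S ∈ R.powerset, coords n b S * coords n c (R \ S) := by
  obtain ⟨p, rfl⟩ := Ideal.Quotient.mk_surjective b
  obtain ⟨q, rfl⟩ := Ideal.Quotient.mk_surjective c
  rw [← map_mul, coords_mk, MvPolynomial.coeff_mul]
  simp only [coords_mk]
  symm
  refine Finset.sum_bij (fun S _ => (sqfreeExponent S, sqfreeExponent (R \ S))) ?_ ?_ ?_ ?_
  · intro S hS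
    rw [mem_powerset] at hS
    rw [HasAntidiagonal.mem_antidiagonal]
    ext i
    simp only [Finsupp.add_apply, sqfreeExponent_apply, mem_sdiff]
    have := @hS i
    by_cases h1 : i ∈ S <;> by_cases h2 : i ∈ R <;> simp_all
  · intro S _ T _ h
    exact sqfreeExponent_injective (congrArg Prod.fst h)
  · rintro ⟨x, y⟩ hxy
    rw [HasAntidiagonal.mem_antidiagonal] at hxy
    have hi : ∀ i, x i + y i = if i ∈ R then 1 else 0 := fun i => by
      rw [← sqfreeExponent_apply, ← hxy]; rfl
    obtain ⟨S, rfl⟩ := exists_sqfreeExponent_eq (x := x) fun i => by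
      have := hi i
      split_ifs at this <;> omega
    refine ⟨S, ?_, ?_⟩
    · rw [mem_powerset]
      intro i hiS
      have := hi i
      rw [sqfreeExponent_apply, if_pos hiS] at this
      by_contra hiR
      rw [if_neg hiR] at this
      omega
    · refine Prod.ext rfl ?_
      ext i
      have := hi i
      rw [sqfreeExponent_apply] at this
      simp only [sqfreeExponent_apply, mem_sdiff]
      by_cases h1 : i ∈ S <;> by_cases h2 : i ∈ R <;> simp_all
  · intro S _
    rfl

theorem coords_sigma {d n : ℕ} (S : Finset (Fin n)) :
    coords n (sigma d n) S = if #S = d then 1 else 0 := by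
  rw [sigma, coords_mk, MvPolynomial.esymm_eq_sum_monomial, MvPolynomial.coeff_sum]
  change ∑ T ∈ powersetCard d univ,
    (MvPolynomial.monomial (sqfreeExponent T) (1 : ZMod 2)).coeff (sqfreeExponent S) = _
  simp only [MvPolynomial.coeff_monomial, sqfreeExponent_injective.eq_iff]
  simp [mem_powersetCard]

theorem sigma_mem (d n : ℕ) : sigma d n ∈ homogeneousPart n d :=
  mem_homogeneousPart_iff.2 fun S hS => by rw [coords_sigma, if_neg hS]

theorem sigma_ne_zero_iff {d n : ℕ} : sigma d n ≠ 0 ↔ d ≤ n := by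
  constructor
  · intro h
    by_contra! hn
    refine h (coords_injective n ?_)
    ext S
    have := card_finset_fin_le S
    rw [coords_sigma, if_neg (by omega), map_zero]
    rfl
  · intro hn h
    obtain ⟨S, hS⟩ := exists_subset_card_eq (s := (univ : Finset (Fin n))) (n := d) (by simpa)
    have := coords_sigma (d := d) S
    rw [h, map_zero, if_pos hS.2] at this
    exact zero_ne_one this

theorem mul_mem_homogeneousPart {n j k : ℕ} {b c : B n} (hb : b ∈ homogeneousPart n j)
    (hc : c ∈ homogeneousPart n k) : b * c ∈ homogeneousPart n (j + k) := by
  rw [mem_homogeneousPart_iff] at *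
  intro R hR
  rw [coords_mul]
  refine sum_eq_zero fun S hS => ?_
  have h1 := card_sdiff_add_card_eq_card (mem_powerset.1 hS)
  by_cases h2 : #S = j
  · rw [hc _ (by omega), mul_zero]
  · rw [hb _ h2, zero_mul]

/-- Multiplication by `sigma d n` adds up coefficients over subsets: its matrix in the squarefree
monomial bases is an inclusion matrix. -/
theorem coords_mul_sigma {n a d : ℕ} (b : B n) {R : Finset (Fin n)} (hR : #R = a + d) :
    coords n (b * sigma d n) R = subsetSum (coords n b) a R := by
  rw [coords_mul, subsetSum, powersetCard_eq_filter, sum_filter]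
  refine sum_congr rfl fun S hS => ?_
  have h1 := card_sdiff_add_card_eq_card (mem_powerset.1 hS)
  rw [coords_sigma]
  by_cases h : #S = a
  · rw [if_pos h, if_pos (by omega), mul_one]
  · rw [if_neg h, if_neg (by omega), mul_zero]

theorem finrank_homogeneousPart (n k : ℕ) :
    Module.finrank (ZMod 2) (homogeneousPart n k) = n.choose k := by
  let f : homogeneousPart n k →ₗ[ZMod 2] ({S : Finset (Fin n) // #S = k} → ZMod 2) :=
    LinearMap.funLeft (ZMod 2) (ZMod 2) Subtype.val ∘ₗ coords n ∘ₗ (homogeneousPart n k).subtype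
  have hf : Function.Bijective f := by
    constructor
    · rw [injective_iff_map_eq_zero]
      intro b hb
      refine Subtype.ext (coords_injective n ?_)
      ext S
      rw [Submodule.coe_zero, map_zero]
      by_cases hS : #S = k
      · exact congrFun hb ⟨S, hS⟩
      · exact mem_homogeneousPart_iff.1 b.2 S hS
    · intro g
      obtain ⟨b, hb⟩ := coords_surjective n fun S => if h : #S = k then g ⟨S, h⟩ else 0
      refine ⟨⟨b, mem_homogeneousPart_iff.2 fun S hS => ?_⟩, ?_⟩
      · simp only [hb, dif_neg hS]
      · ext ⟨S, hS⟩
        change coords n b S = _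
        simp only [hb, dif_pos hS]
  rw [(LinearEquiv.ofBijective f hf).finrank_eq, Module.finrank_fintype_fun_eq_card,
    Fintype.card_finset_len, Fintype.card_fin]

/-! ### Multiplication by an elementary symmetric polynomial -/

theorem subsetSum_coords_eq_zero {n a d : ℕ} {b : B n} (h : b * sigma d n = 0)
    (R : Finset (Fin n)) (hR : #R = a + d) : subsetSum (coords n b) a R = 0 := by
  rw [← coords_mul_sigma b hR, h, map_zero, Pi.zero_apply]

/-- Multiplication by `sigma d n` is injective in degrees below both `2 ^ m` and the middle: every
coefficient is an inclusion–exclusion sum of subset sums, all of which vanish. -/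
theorem eq_zero_of_mul_sigma_eq_zero {n a d m : ℕ} (hd : 2 ^ m ∣ d) (ha : a < 2 ^ m)
    (hn : 2 * a + d ≤ n) {b : B n} (hb : b ∈ homogeneousPart n a) (h : b * sigma d n = 0) :
    b = 0 := by
  apply coords_injective n
  ext U
  rw [map_zero, Pi.zero_apply]
  by_cases hU : #U = a
  · obtain ⟨D, hDU, hD⟩ := exists_subset_card_eq (s := Uᶜ) (n := a + d)
      (by rw [card_compl, Fintype.card_fin]; omega)
    have hdisj : Disjoint D U := (subset_compl_iff_disjoint_right.1 hDU)
    rw [← sum_powerset_subsetSum_union (coords n b) hdisj hU]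
    refine sum_eq_zero fun X hX => ?_
    rw [mem_powerset] at hX
    have h1 := card_le_card hX
    have h2 := card_union_of_disjoint (hdisj.mono_right hX)
    exact subsetSum_eq_zero hd (subsetSum_coords_eq_zero h) (by omega) (by omega)
  · exact mem_homogeneousPart_iff.1 hb U hU

/-- In `3 * 2 ^ m` variables only the whole set of variables contributes to the
inclusion–exclusion formula, so that all the coefficients of `b` coincide. -/
theorem exists_smul_sigma_eq {m : ℕ} {b : B (3 * 2 ^ m)}
    (hb : b ∈ homogeneousPart (3 * 2 ^ m) (2 ^ m)) (h : b * sigma (2 ^ m) (3 * 2 ^ m) = 0) :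
    ∃ c : ZMod 2, b = c • sigma (2 ^ m) (3 * 2 ^ m) := by
  refine ⟨subsetSum (coords _ b) (2 ^ m) univ, coords_injective _ ?_⟩
  ext U
  rw [map_smul, Pi.smul_apply, coords_sigma]
  by_cases hU : #U = 2 ^ m
  · have hdisj : Disjoint Uᶜ U := disjoint_compl_left
    have hc : #Uᶜ = 2 ^ m + 2 ^ m := by
      rw [card_compl, Fintype.card_fin]; omega
    rw [← sum_powerset_subsetSum_union (coords _ b) hdisj hU, Finset.sum_eq_single U]
    · rw [union_comm, union_compl, if_pos hU, smul_eq_mul, mul_one]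
    · intro X hX hne
      have hlt := card_lt_card ((mem_powerset.1 hX).ssubset_of_ne hne)
      have h2 := card_union_of_disjoint (hdisj.mono_right (mem_powerset.1 hX))
      exact subsetSum_eq_zero dvd_rfl (subsetSum_coords_eq_zero h) (by omega) (by omega)
    · intro h
      exact absurd (mem_powerset_self U) h
  · rw [if_neg hU, smul_zero]
    exact mem_homogeneousPart_iff.1 hb U hU

theorem sigma_mul_sigma (d e n : ℕ) :
    sigma e n * sigma d n = ((e + d).choose e : B n) * sigma (e + d) n := by
  rw [← nsmul_eq_mul]
  apply coords_injective n
  ext R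
  rw [map_nsmul, Pi.smul_apply, coords_sigma]
  by_cases hR : #R = e + d
  · rw [coords_mul_sigma _ hR, subsetSum, if_pos hR, nsmul_eq_mul, mul_one, ← hR,
      ← card_powersetCard, ← nsmul_one, ← sum_const]
    exact sum_congr rfl fun S hS => by rw [coords_sigma, if_pos (mem_powersetCard.1 hS).2]
  · rw [if_neg hR, smul_zero]
    exact mem_homogeneousPart_iff.1 (mul_mem_homogeneousPart (sigma_mem e n) (sigma_mem d n)) R hR

theorem sigma_two_pow_mul_sigma {m l : ℕ} (hl : Odd l) (n : ℕ) :
    sigma (2 ^ m) n * sigma (2 ^ m * l) n = 0 := by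
  obtain ⟨c, hc⟩ := even_choose_two_pow_mul_succ (m := m) hl
  have h2 : ((2 : ℕ) : B n) = 0 := by
    have := map_natCast (algebraMap (ZMod 2) (B n)) 2
    rw [← this, show ((2 : ℕ) : ZMod 2) = 0 from rfl, map_zero]
  rw [sigma_mul_sigma, add_comm, hc, ← two_mul, Nat.cast_mul, h2, zero_mul, zero_mul]

/-! ### Ranks and duality -/

/-- The rank of multiplication by `sigma d n` on the homogeneous part of degree `a`. -/
noncomputable def sigmaRank (d n a : ℕ) : ℕ :=
  Module.finrank (ZMod 2)
    ((homogeneousPart n a).map (LinearMap.mulRight (ZMod 2) (sigma d n)))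

/-- The matrix in the squarefree monomial bases of multiplication by `sigma d n` on the
homogeneous part of degree `a`, padded with zeros: the inclusion matrix of the `a`-subsets against
the `(a + d)`-subsets. -/
def inclusionMatrix (d n a : ℕ) : Matrix (Finset (Fin n)) (Finset (Fin n)) (ZMod 2) :=
  Matrix.of fun R S => if #S = a ∧ #R = a + d ∧ S ⊆ R then 1 else 0

theorem inclusionMatrix_mulVec {d n a : ℕ} (f : Finset (Fin n) → ZMod 2) (R : Finset (Fin n)) :
    (inclusionMatrix d n a).mulVec f R = if #R = a + d then subsetSum f a R else 0 := by
  simp only [Matrix.mulVec, dotProduct, inclusionMatrix, Matrix.of_apply, ite_mul, one_mul,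
    zero_mul, subsetSum]
  split_ifs with hR
  · rw [← sum_filter]
    refine sum_congr ?_ fun _ _ => rfl
    ext S
    simp only [mem_filter, mem_univ, true_and, mem_powersetCard, hR]
    tauto
  · exact sum_eq_zero fun S _ => if_neg fun h => hR h.2.1

theorem exists_mem_homogeneousPart_coords_eq {n : ℕ} (a : ℕ) (f : Finset (Fin n) → ZMod 2) :
    ∃ z ∈ homogeneousPart n a, ∀ S, #S = a → coords n z S = f S := by
  obtain ⟨z, hz⟩ := coords_surjective n fun S => if #S = a then f S else 0
  refine ⟨z, mem_homogeneousPart_iff.2 fun S hS => ?_, fun S hS => ?_⟩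
  · simp only [hz, if_neg hS]
  · simp only [hz, if_pos hS]

theorem inclusionMatrix_mulVec_coords {d n a : ℕ} {b : B n} (hb : b ∈ homogeneousPart n a) :
    (inclusionMatrix d n a).mulVec (coords n b) = coords n (b * sigma d n) := by
  ext R
  rw [inclusionMatrix_mulVec]
  split_ifs with hR
  · rw [coords_mul_sigma b hR]
  · exact (mem_homogeneousPart_iff.1 (mul_mem_homogeneousPart hb (sigma_mem d n)) R hR).symm

theorem subsetSum_congr {α : Type*} {v w : Finset α → ZMod 2} {a : ℕ}
    (h : ∀ S, #S = a → v S = w S) (R : Finset α) : subsetSum v a R = subsetSum w a R :=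
  sum_congr rfl fun S hS => h S (mem_powersetCard.1 hS).2

theorem sigmaRank_eq_rank (d n a : ℕ) : sigmaRank d n a = (inclusionMatrix d n a).rank := by
  rw [sigmaRank, Matrix.rank, ← (coordsEquiv n).finrank_map_eq]
  refine congrArg (fun V : Submodule (ZMod 2) (Finset (Fin n) → ZMod 2) =>
    Module.finrank (ZMod 2) V) ?_
  ext f
  constructor
  · rintro ⟨_, ⟨b, hb, rfl⟩, rfl⟩
    exact ⟨coords n b, inclusionMatrix_mulVec_coords hb⟩
  · rintro ⟨g, rfl⟩
    obtain ⟨z, hz, hzg⟩ := exists_mem_homogeneousPart_coords_eq a g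
    refine ⟨_, ⟨z, hz, rfl⟩, ?_⟩
    change coords n (z * sigma d n) = (inclusionMatrix d n a).mulVec g
    rw [← inclusionMatrix_mulVec_coords hz]
    ext R
    simp only [inclusionMatrix_mulVec, subsetSum_congr hzg]

/-- Taking complements of index sets transposes the inclusion matrix. -/
theorem sigmaRank_compl {d n a : ℕ} (h : a + d ≤ n) :
    sigmaRank d n (n - a - d) = sigmaRank d n a := by
  rw [sigmaRank_eq_rank, sigmaRank_eq_rank, ← Matrix.rank_transpose (inclusionMatrix d n a),
    ← Matrix.rank_submatrix (inclusionMatrix d n a).transpose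
      (compl_involutive (α := Finset (Fin n))).toPerm
      (compl_involutive (α := Finset (Fin n))).toPerm]
  congr 1
  ext R S
  have hR := card_compl R
  have hS := card_compl S
  have hR' := card_finset_fin_le R
  have hS' := card_finset_fin_le S
  rw [Fintype.card_fin] at hR hS
  simp only [inclusionMatrix, Matrix.of_apply, Matrix.submatrix_apply, Matrix.transpose_apply,
    Function.Involutive.coe_toPerm, compl_subset_compl]
  refine if_congr ?_ rfl rfl
  constructor
  · rintro ⟨h1, h2, h3⟩
    exact ⟨by omega, by omega, h3⟩
  · rintro ⟨h1, h2, h3⟩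
    exact ⟨by omega, by omega, h3⟩

theorem sigmaRank_add_finrank_ker (d n a : ℕ) :
    sigmaRank d n a + Module.finrank (ZMod 2)
      (homogeneousPart n a ⊓ LinearMap.ker (LinearMap.mulRight (ZMod 2) (sigma d n)) :
        Submodule (ZMod 2) (B n)) = n.choose a := by
  have h := LinearMap.finrank_range_add_finrank_ker
    ((LinearMap.mulRight (ZMod 2) (sigma d n)).domRestrict (homogeneousPart n a))
  rw [finrank_homogeneousPart, LinearMap.range_domRestrict, LinearMap.ker_domRestrict] at h
  rw [← h, sigmaRank, ← Submodule.map_comap_subtype,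
    Submodule.finrank_map_subtype_eq]

theorem sigmaRank_le (d n a : ℕ) : sigmaRank d n a ≤ n.choose a :=
  (Nat.le_add_right _ _).trans (sigmaRank_add_finrank_ker d n a).le

theorem homogeneousPart_eq_bot {n k : ℕ} (h : n < k) : homogeneousPart n k = ⊥ := by
  rw [← Submodule.finrank_eq_zero (R := ZMod 2), finrank_homogeneousPart,
    Nat.choose_eq_zero_of_lt h]

theorem map_mulRight_sigma_le (d n a : ℕ) :
    (homogeneousPart n a).map (LinearMap.mulRight (ZMod 2) (sigma d n)) ≤
      homogeneousPart n (a + d) := by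
  rintro _ ⟨b, hb, rfl⟩
  exact mul_mem_homogeneousPart hb (sigma_mem d n)

theorem sigmaRank_eq_zero {d n a : ℕ} (h : n < a + d) : sigmaRank d n a = 0 := by
  have := map_mulRight_sigma_le d n a
  rw [homogeneousPart_eq_bot h, le_bot_iff] at this
  rw [sigmaRank, this, finrank_bot]

theorem sigmaRank_eq_choose {n a d m : ℕ} (hd : 2 ^ m ∣ d) (ha : a < 2 ^ m)
    (hn : 2 * a + d ≤ n) : sigmaRank d n a = n.choose a := by
  have h := sigmaRank_add_finrank_ker d n a
  have hbot : homogeneousPart n a ⊓ LinearMap.ker (LinearMap.mulRight (ZMod 2) (sigma d n)) = ⊥ :=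
    (Submodule.eq_bot_iff _).2 fun b hb =>
      eq_zero_of_mul_sigma_eq_zero hd ha hn hb.1 hb.2
  rwa [hbot, finrank_bot, add_zero] at h

/-- The surjectivity statement dual to `eq_zero_of_mul_sigma_eq_zero`. -/
theorem homogeneousPart_le_map_mulRight_sigma {n a d m : ℕ} (hd : 2 ^ m ∣ d)
    (ha : n - a - d < 2 ^ m) (had : a + d ≤ n) (hn : n ≤ 2 * a + d) :
    homogeneousPart n (a + d) ≤
      (homogeneousPart n a).map (LinearMap.mulRight (ZMod 2) (sigma d n)) := by
  refine (Submodule.eq_of_le_of_finrank_le (map_mulRight_sigma_le d n a) ?_).ge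
  change _ ≤ sigmaRank d n a
  rw [← sigmaRank_compl had, sigmaRank_eq_choose hd ha (by omega), finrank_homogeneousPart,
    ← Nat.choose_symm had, show n - (a + d) = n - a - d by omega]

/-! ### The index and the ideal generated by a symmetric polynomial -/

theorem exists_eq_mul_sigma {n d k : ℕ} {x : B n} (hx : x ∈ homogeneousPart n k)
    (h : x ∈ Ideal.span {sigma d n}) (hdk : d ≤ k) :
    ∃ z ∈ homogeneousPart n (k - d), x = z * sigma d n := by
  obtain ⟨y, rfl⟩ := Ideal.mem_span_singleton'.1 h
  obtain ⟨z, hz, hzy⟩ := exists_mem_homogeneousPart_coords_eq (k - d) (coords n y)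
  refine ⟨z, hz, coords_injective n ?_⟩
  ext R
  by_cases hR : #R = k
  · rw [coords_mul_sigma (a := k - d) _ (by omega), coords_mul_sigma (a := k - d) _ (by omega),
      subsetSum_congr hzy]
  · rw [mem_homogeneousPart_iff.1 hx R hR,
      mem_homogeneousPart_iff.1 (mul_mem_homogeneousPart hz (sigma_mem d n)) R (by omega)]

theorem eq_zero_of_mem_span_sigma {n d k : ℕ} {x : B n} (hx : x ∈ homogeneousPart n k)
    (h : x ∈ Ideal.span {sigma d n}) (hdk : k < d) : x = 0 := by
  obtain ⟨y, rfl⟩ := Ideal.mem_span_singleton'.1 h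
  apply coords_injective n
  ext R
  rw [map_zero, Pi.zero_apply]
  by_cases hR : #R = k
  · rw [coords_mul]
    refine sum_eq_zero fun S _ => ?_
    have := card_le_card (sdiff_subset (s := R) (t := S))
    rw [coords_sigma, if_neg (by omega), mul_zero]
  · exact mem_homogeneousPart_iff.1 hx R hR

theorem index_le {n k : ℕ} {I : Ideal (B n)} (h : ∀ b ∈ homogeneousPart n k, b ∈ I) :
    index I ≤ k := Nat.sInf_le h

theorem index_le_succ {n : ℕ} (I : Ideal (B n)) : index I ≤ n + 1 := by
  refine index_le fun b hb => ?_
  rw [homogeneousPart_eq_bot (Nat.lt_succ_self n), Submodule.mem_bot] at hb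
  rw [hb]
  exact I.zero_mem

theorem forall_mem_of_index {n : ℕ} (I : Ideal (B n)) :
    ∀ b ∈ homogeneousPart n (index I), b ∈ I := by
  refine Nat.sInf_mem (s := {k : ℕ | ∀ b ∈ homogeneousPart n k, b ∈ I}) ⟨n + 1, fun b hb => ?_⟩
  rw [homogeneousPart_eq_bot (Nat.lt_succ_self n), Submodule.mem_bot] at hb
  rw [hb]
  exact I.zero_mem

/-- A nonzero homogeneous element `μ` of degree `e` does not annihilate the monomials of degree at
most `n - e` whose variables avoid those of some monomial of `μ`. -/
theorem sub_lt_index {n e : ℕ} {g μ : B n} (hμ : μ ∈ homogeneousPart n e) (hne : μ ≠ 0)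
    (h : μ * g = 0) : n - e < index (Ideal.span {g}) := by
  by_contra! hle
  obtain ⟨S, hS⟩ : ∃ S, coords n μ S ≠ 0 := by
    by_contra! hcon
    exact hne (coords_injective n (by ext S; rw [hcon, map_zero]; rfl))
  have hSe : #S = e := by
    by_contra hSe
    exact hS (mem_homogeneousPart_iff.1 hμ S hSe)
  obtain ⟨K, hKS, hK⟩ := exists_subset_card_eq (s := Sᶜ) (n := index (Ideal.span {g}))
      (by rw [card_compl, Fintype.card_fin]; omega)
  have hdisj : Disjoint K S := subset_compl_iff_disjoint_right.1 hKS
  obtain ⟨y, hy⟩ := Ideal.mem_span_singleton'.1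
    (forall_mem_of_index (Ideal.span {g}) _ (hK ▸ sqfreeMonomial_mem K))
  have hzero : coords n (μ * sqfreeMonomial K) (S ∪ K) = 0 := by
    rw [← hy, mul_left_comm, h, mul_zero, map_zero, Pi.zero_apply]
  rw [coords_mul, Finset.sum_eq_single S] at hzero
  · rw [union_sdiff_cancel_left hdisj.symm, coords_sqfreeMonomial, if_pos rfl, mul_one] at hzero
    exact hS hzero
  · intro T hT hTS
    rw [coords_sqfreeMonomial, if_neg, mul_zero]
    intro hKT
    refine hTS ?_
    rw [← Finset.sdiff_sdiff_eq_self (mem_powerset.1 hT), ← hKT,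
      union_sdiff_cancel_right hdisj.symm]
  · intro h
    exact absurd (mem_powerset.2 subset_union_left) h

theorem isSemiRegularElement_sigma_iff {d n : ℕ} (hd : 0 < d) :
    IsSemiRegularElement (sigma d n) ↔ d ≤ n ∧ ∀ (a : ℕ) (μ : B n), μ ∈ homogeneousPart n a →
      a + d < index (Ideal.span {sigma d n}) → μ * sigma d n = 0 →
        μ ∈ Ideal.span {sigma d n} := by
  have hIio : (fun _ : Fin 1 => sigma d n) '' Set.Iio 0 = ∅ := by
    rw [Set.image_eq_empty]; ext i; simp
  have hIic : (fun _ : Fin 1 => sigma d n) '' Set.Iic 0 = {sigma d n} :=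
    Set.Nonempty.image_const (s := Set.Iic 0) ⟨0, Set.self_mem_Iic⟩ _
  unfold IsSemiRegularElement IsSemiRegular IsSemiRegularUpTo
  rw [Set.range_const]
  constructor
  · rintro ⟨h1, h2⟩
    refine ⟨sigma_ne_zero_iff.1 (h1 0).1, fun a μ hμ ha h => ?_⟩
    have := h2 0 a d μ hμ (sigma_mem d n) ha
    rw [hIio, hIic, Ideal.span_empty, Ideal.mem_bot] at this
    exact this h
  · rintro ⟨h1, h2⟩
    refine ⟨fun _ => ⟨sigma_ne_zero_iff.2 h1, d, hd, sigma_mem d n⟩, fun i a e μ hμ he ha h => ?_⟩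
    obtain rfl : e = d := by
      by_contra hne
      refine sigma_ne_zero_iff.2 h1 (coords_injective n ?_)
      ext S
      rw [map_zero, Pi.zero_apply]
      by_cases hS : #S = d
      · exact mem_homogeneousPart_iff.1 he S (by omega)
      · exact mem_homogeneousPart_iff.1 (sigma_mem d n) S hS
    rw [Subsingleton.elim i 0, hIio, Ideal.span_empty, Ideal.mem_bot] at h
    rw [Subsingleton.elim i 0, hIic]
    exact h2 a μ hμ ha h

/-! ### The range in which the symmetric polynomial is semi-regular -/

theorem index_span_sigma_le {n a d m : ℕ} (hd : 2 ^ m ∣ d) (ha : n - a - d < 2 ^ m)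
    (had : a + d ≤ n) (hn : n ≤ 2 * a + d) : index (Ideal.span {sigma d n}) ≤ a + d := by
  refine index_le fun b hb => ?_
  obtain ⟨z, -, rfl⟩ := homogeneousPart_le_map_mulRight_sigma hd ha had hn hb
  exact Ideal.mul_mem_left _ _ (Ideal.mem_span_singleton_self _)

/-- Below the index, the source degree `a` lies in the lower half of the degrees, up to the
symmetry `a ↦ n - a - d`. -/
theorem two_mul_add_le_of_lt_index {n a d m : ℕ} (hd : 2 ^ m ∣ d) (hn : n ≤ d + 2 ^ (m + 1))
    (ha : a + d < index (Ideal.span {sigma d n})) : 2 * a + d ≤ n := by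
  by_contra! hlt
  have h1 := index_le_succ (Ideal.span {sigma d n})
  rw [pow_succ] at hn
  have h2 := index_span_sigma_le (n := n) (a := a) hd (by omega) (by omega) (by omega)
  omega

theorem isSemiRegularElement_sigma_of_lt {n d m : ℕ} (hd0 : 0 < d) (hd : 2 ^ m ∣ d) (hdn : d ≤ n)
    (hn : n < d + 2 ^ (m + 1)) : IsSemiRegularElement (sigma d n) := by
  refine (isSemiRegularElement_sigma_iff hd0).2 ⟨hdn, fun a μ hμ ha h => ?_⟩
  have h1 := two_mul_add_le_of_lt_index hd hn.le ha
  rw [pow_succ] at hn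
  rw [eq_zero_of_mul_sigma_eq_zero hd (by omega) h1 hμ h]
  exact Ideal.zero_mem _

/-- In the boundary degree `a = 2 ^ m` the kernel is spanned by the symmetric polynomial itself. -/
theorem isSemiRegularElement_sigma_three_mul (m : ℕ) :
    IsSemiRegularElement (sigma (2 ^ m) (3 * 2 ^ m)) := by
  refine (isSemiRegularElement_sigma_iff (by positivity)).2 ⟨by omega, fun a μ hμ ha h => ?_⟩
  have h1 := two_mul_add_le_of_lt_index dvd_rfl (by rw [pow_succ]; omega) ha
  obtain h2 | rfl : a < 2 ^ m ∨ a = 2 ^ m := by omega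
  · rw [eq_zero_of_mul_sigma_eq_zero dvd_rfl h2 h1 hμ h]
    exact Ideal.zero_mem _
  · obtain ⟨c, rfl⟩ := exists_smul_sigma_eq hμ h
    exact Submodule.smul_of_tower_mem _ c (Ideal.mem_span_singleton_self _)

/-! ### Failure of semi-regularity for many variables -/

/-- The witness is `sigma (2 ^ m) n`, an annihilator of too small a degree to lie in the ideal. -/
theorem not_isSemiRegularElement_sigma {n m l : ℕ} (hl : Odd l) (hl1 : 1 < l)
    (hn : 2 ^ m * l + 2 ^ (m + 1) ≤ n) : ¬ IsSemiRegularElement (sigma (2 ^ m * l) n) := by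
  have hm : 0 < 2 ^ m := by positivity
  have hml : 2 ^ m < 2 ^ m * l := lt_mul_of_one_lt_right hm hl1
  rw [pow_succ] at hn
  intro h
  have h1 := sigma_two_pow_mul_sigma (m := m) hl n
  have hne : sigma (2 ^ m) n ≠ 0 := sigma_ne_zero_iff.2 (by omega)
  have hidx := sub_lt_index (sigma_mem _ n) hne h1
  have hmem := ((isSemiRegularElement_sigma_iff (by omega)).1 h).2 _ _ (sigma_mem (2 ^ m) n)
    (by omega) h1
  exact hne (eq_zero_of_mem_span_sigma (sigma_mem _ n) hmem hml)

/-- Exactness in degree `a` of multiplication by `sigma d n`, as an equality of dimensions. -/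
theorem choose_eq_sigmaRank_add {n d a : ℕ} (hsq : sigma d n * sigma d n = 0)
    (h : ∀ μ ∈ homogeneousPart n a, μ * sigma d n = 0 → μ ∈ Ideal.span {sigma d n}) :
    n.choose a = sigmaRank d n a + if d ≤ a then sigmaRank d n (a - d) else 0 := by
  rw [← sigmaRank_add_finrank_ker d n a]
  congr 1
  split_ifs with hda
  · rw [sigmaRank]
    refine congrArg (fun V : Submodule (ZMod 2) (B n) => Module.finrank (ZMod 2) V)
      (le_antisymm ?_ ?_)
    · rintro μ ⟨hμ, hker⟩
      obtain ⟨z, hz, rfl⟩ := exists_eq_mul_sigma hμ (h μ hμ hker) hda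
      exact ⟨z, hz, rfl⟩
    · rintro _ ⟨z, hz, rfl⟩
      refine ⟨?_, ?_⟩
      · have := mul_mem_homogeneousPart hz (sigma_mem d n)
        rwa [Nat.sub_add_cancel hda] at this
      · change z * sigma d n * sigma d n = 0
        rw [mul_assoc, hsq, mul_zero]
  · rw [Submodule.finrank_eq_zero, Submodule.eq_bot_iff]
    rintro μ ⟨hμ, hker⟩
    exact eq_zero_of_mem_span_sigma hμ (h μ hμ hker) (by omega)

theorem choose_le_choose_of_le_half {n i j : ℕ} (hij : i ≤ j) (hj : j ≤ n / 2) :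
    n.choose i ≤ n.choose j := by
  induction j, hij using Nat.le_induction with
  | base => rfl
  | succ k _ ih => exact (ih (by omega)).trans (Nat.choose_le_succ_of_lt_half_left (by omega))

/-- By unimodality `e` may be replaced by `d - 1` on the left and by `1` on the right; the three
remaining binomial coefficients are compared through the ratios of consecutive ones. -/
theorem choose_add_choose_lt {d e : ℕ} (he : 1 ≤ e) (hed : e < d) :
    (3 * d + e).choose d + (3 * d + e).choose e < (3 * d + e).choose (d + e) := by
  have h1 : (3 * d + e).choose (d + 1) ≤ (3 * d + e).choose (d + e) :=
    choose_le_choose_of_le_half (by omega) (by omega)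
  have h2 : (3 * d + e).choose e ≤ (3 * d + e).choose (d - 1) :=
    choose_le_choose_of_le_half (by omega) (by omega)
  have h3 := Nat.choose_succ_right_eq (3 * d + e) d
  have h4 := Nat.choose_succ_right_eq (3 * d + e) (d - 1)
  have h5 : 0 < (3 * d + e).choose (d - 1) := Nat.choose_pos (by omega)
  obtain ⟨c, rfl⟩ : ∃ c, d = e + c + 1 := ⟨d - e - 1, by omega⟩
  rw [show 3 * (e + c + 1) + e - (e + c + 1) = 3 * e + 2 * c + 2 by omega] at h3
  rw [show e + c + 1 - 1 = e + c by omega] at h2 h4 h5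
  rw [show 3 * (e + c + 1) + e - (e + c) = 3 * e + 2 * c + 3 by omega] at h4
  generalize (3 * (e + c + 1) + e).choose (e + c + 1 + 1) = P at *
  generalize (3 * (e + c + 1) + e).choose (e + c + 1) = A at *
  generalize (3 * (e + c + 1) + e).choose (e + c) = Q at *
  have h6 : 2 * Q < A := by
    by_contra! hcon
    nlinarith
  have h7 : A + Q < P := by
    by_contra! hcon
    nlinarith
  omega

/-- The equations say that `(1 + X) ^ n = (1 + X ^ d) * ∑ a, r a * X ^ a`; a complex root of
`1 + X ^ d` would then be `-1`, which is not one for even `d`. -/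
theorem not_forall_choose_eq_add {d n : ℕ} (hd : Even d) (hd0 : 0 < d) (r : ℕ → ℕ)
    (hr : ∀ a, n < a → r a = 0) :
    ¬ ∀ a, n.choose a = r a + if d ≤ a then r (a - d) else 0 := by
  intro h
  obtain ⟨z, hz⟩ := IsAlgClosed.exists_pow_nat_eq (-1 : ℂ) hd0
  let q : Polynomial ℂ := ∑ a ∈ range (n + 1), Polynomial.monomial a (r a : ℂ)
  have hq : ∀ a, q.coeff a = r a := fun a => by
    simp only [q, Polynomial.finsetSum_coeff, Polynomial.coeff_monomial, sum_ite_eq', mem_range]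
    split_ifs with ha
    · rfl
    · rw [hr a (by omega), Nat.cast_zero]
  have hfac : (1 + Polynomial.X) ^ n = q + Polynomial.X ^ d * q := by
    ext a
    rw [Polynomial.coeff_one_add_X_pow, Polynomial.coeff_add, Polynomial.coeff_X_pow_mul', hq, hq,
      h a]
    split_ifs <;> simp
  have heval := congrArg (Polynomial.eval z) hfac
  simp only [Polynomial.eval_pow, Polynomial.eval_add, Polynomial.eval_one, Polynomial.eval_X,
    Polynomial.eval_mul, hz, neg_mul, one_mul, add_neg_cancel] at heval
  have hz1 : z = -1 := (neg_eq_of_add_eq_zero_right (eq_zero_of_pow_eq_zero heval)).symm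
  rw [hz1, hd.neg_one_pow] at hz
  norm_num at hz

theorem not_isSemiRegularElement_sigma_two_pow {n m : ℕ} (hm : 1 ≤ m) (hn : 3 * 2 ^ m < n) :
    ¬ IsSemiRegularElement (sigma (2 ^ m) n) := by
  intro h
  have hsq : sigma (2 ^ m) n * sigma (2 ^ m) n = 0 := by
    simpa using sigma_two_pow_mul_sigma (m := m) odd_one n
  have hd0 : 0 < 2 ^ m := by positivity
  have hdeven : Even (2 ^ m) := (even_two).pow_of_ne_zero (by omega)
  obtain ⟨-, h⟩ := (isSemiRegularElement_sigma_iff hd0).1 h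
  generalize 2 ^ m = d at *
  have hidx := sub_lt_index (sigma_mem d n) (sigma_ne_zero_iff.2 (by omega)) hsq
  have hex : ∀ a, a + 2 * d ≤ n →
      n.choose a = sigmaRank d n a + if d ≤ a then sigmaRank d n (a - d) else 0 := fun a ha =>
    choose_eq_sigmaRank_add hsq fun μ hμ => h a μ hμ (by omega)
  rcases lt_or_ge n (4 * d) with hlt | hge
  · obtain ⟨e, rfl⟩ : ∃ e, n = 3 * d + e := ⟨n - 3 * d, by omega⟩
    -- The map out of degree `d + e = n - 2 * d` is dual to the one out of degree `d`.
    have h1 := hex (d + e) (by omega)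
    rw [if_pos (by omega), ← sigmaRank_compl (by omega),
      show 3 * d + e - (d + e) - d = d by omega, Nat.add_sub_cancel_left] at h1
    have h2 := choose_add_choose_lt (d := d) (e := e) (by omega) (by omega)
    have h3 := sigmaRank_le d (3 * d + e) d
    have h4 := sigmaRank_le d (3 * d + e) e
    omega
  · -- Duality turns exactness in degree `n - a` into exactness in degree `a`.
    refine not_forall_choose_eq_add hdeven hd0 (sigmaRank d n) (n := n)
      (fun a ha => sigmaRank_eq_zero (by omega)) fun a => ?_
    by_cases ha : a + 2 * d ≤ n
    · exact hex a ha
    rw [if_pos (by omega)]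
    by_cases han : a ≤ n
    · have h1 := hex (n - a) (by omega)
      rw [Nat.choose_symm han] at h1
      have h2 := sigmaRank_compl (d := d) (n := n) (a := a - d) (by omega)
      rw [show n - (a - d) - d = n - a by omega] at h2
      rw [h1, h2]
      split_ifs with hda
      · rw [sigmaRank_compl (by omega), add_comm]
      · rw [sigmaRank_eq_zero (a := a) (by omega), add_comm]
    · rw [Nat.choose_eq_zero_of_lt (by omega), sigmaRank_eq_zero (a := a) (by omega),
        sigmaRank_eq_zero (a := a - d) (by omega)]

end SemiRegular

theorem mainTheorem2 :
    (∀ d m l : ℕ, 2 ≤ d → d = 2 ^ m * l → Odd l →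
      (1 < l → ∀ n : ℕ, SemiRegular.IsSemiRegularElement (SemiRegular.sigma d n) ↔
        d ≤ n ∧ n ≤ d + 2 ^ (m + 1) - 1) ∧
      (l = 1 → ∀ n : ℕ, SemiRegular.IsSemiRegularElement (SemiRegular.sigma d n) ↔
        d ≤ n ∧ n ≤ d + 2 ^ (m + 1))) ∧
    (∀ t : ℕ, 1 ≤ t →
      SemiRegular.IsSemiRegularElement (SemiRegular.sigma (2 ^ t) (3 * 2 ^ t))) ∧
    {d : ℕ | 2 ≤ d ∧ ∃ g : SemiRegular.B (3 * d),
      g ∈ SemiRegular.homogeneousPart (3 * d) d ∧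
        SemiRegular.IsSemiRegularElement g}.Infinite := by
  refine ⟨?_, fun t _ => SemiRegular.isSemiRegularElement_sigma_three_mul t, ?_⟩
  · rintro d m l hd rfl hl
    have hm : 0 < 2 ^ (m + 1) := by positivity
    have hle : ∀ n, SemiRegular.IsSemiRegularElement (SemiRegular.sigma (2 ^ m * l) n) →
        2 ^ m * l ≤ n :=
      fun n h => ((SemiRegular.isSemiRegularElement_sigma_iff (by omega)).1 h).1
    refine ⟨fun hl1 n => ⟨fun h => ⟨hle n h, ?_⟩, fun h => ?_⟩, ?_⟩
    · by_contra! hcon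
      exact SemiRegular.not_isSemiRegularElement_sigma hl hl1 (by omega) h
    · exact SemiRegular.isSemiRegularElement_sigma_of_lt (by omega) (dvd_mul_right _ _) h.1
        (by omega)
    · rintro rfl n
      have hm1 : 1 ≤ m := by
        by_contra! h0
        obtain rfl : m = 0 := by omega
        omega
      rw [mul_one] at hd hle ⊢
      refine ⟨fun h => ⟨hle n h, ?_⟩, fun h => ?_⟩
      · by_contra! hcon
        rw [pow_succ] at hcon
        exact SemiRegular.not_isSemiRegularElement_sigma_two_pow hm1 (by omega) h
      · rcases h.2.lt_or_eq with hlt | heq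
        · exact SemiRegular.isSemiRegularElement_sigma_of_lt (by omega) dvd_rfl h.1 hlt
        · obtain rfl : n = 3 * 2 ^ m := by rw [heq, pow_succ]; ring
          exact SemiRegular.isSemiRegularElement_sigma_three_mul m
  · refine Set.infinite_of_injective_forall_mem (f := fun t : ℕ => 2 ^ (t + 1)) ?_ fun t => ?_
    · intro s t hst
      have := Nat.pow_right_injective le_rfl hst
      omega
    · exact ⟨by rw [pow_succ]; have : 0 < 2 ^ t := by positivity
                omega, _, SemiRegular.sigma_mem _ _,
        SemiRegular.isSemiRegularElement_sigma_three_mul (t + 1)⟩
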